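/- Let $X$ be a real Banach space with closed unit ball $B_X$ and dual $X^*$, let $I$ be a nonempty compact metric space, and let $\{A_i : i\in I\}$ be closed convex subsets of $X$ with $A:=\bigcap_{i\in I}A_i\neq\emptyset$, such that $i\mapsto A_i$ is lower semicontinuous: for all $i_0\in I$, $y_0\in A_{i_0}$ and every neighborhood $V$ of $y_0$ there is a neighborhood $U$ of $i_0$ with $V\cap A_i\neq\emptyset$ for all $i\in U$. For a convex set $C\subset X$ and $x\in C$, let $T(C,x)$ be the norm closure of the convex cone generated by $C-x$, and let $N(C,x):=\{x^*\in X^* : \langle x^*,c-x\rangle\le 0\ \ \forall c\in C\}$. The system $\{A_i\}$ has the CHIP if $T(A,x)=\bigcap_{i\in I}T(A_i,x)$ for every $x\in A$. A system $\{C_i : i\in I\}$ of convex sets in $X$ with nonempty intersection has the linear regularity property with constant $\gamma>0$ if $$d\Big(x,\bigcap_{i\in I}C_i\Big)\le\gamma\sup_{i\in I}d(x,C_i)\quad\text{for all }x\in X,$$ and the normal property with constant $\eta>0$ if $$\bigcap_{i\in I}(C_i+\eta B_X)\subset\Big(\bigcap_{i\in I}C_i\Big)+B_X .$$ A system $\{P_i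 : i\in I\}$ of weak$^*$-closed convex cones in $X^*$ has property $(G_\eta)$, where $\eta>0$, if for every $x^*$ in the weak$^*$ closure of $\sum_{i\in I}P_i:=\{\sum_{i\in J}p_i : \emptyset\ne J\subset I\text{ finite},\ p_i\in P_i\}$ there are a net $(I_k)$ of finite subsets of $I$ and elements $x^*_{i,k}\in P_i$ $(i\in I_k)$ such that $\sum_{i\in I_k}x^*_{i,k}\to x^*$ in the weak$^*$ topology and $\sum_{i\in I_k}\|x^*_{i,k}\|\le\frac1\eta\|x^*\|$ for all $k$. Then the following statements are equivalent: (i) there is $\gamma>0$ such that $\{A_i : i\in I\}$ has the linear regularity property with constant $\gamma$; (ii) $\{A_i : i\in I\}$ has the CHIP and there is $\eta>0$ such that, for every $x\in A$, $\{T(A_i,x) : i\in I\}$ has the normal property with the same constant $\eta$; (iii) $\{A_i : i\in I\}$ has the CHIP and there is $\eta>0$ such that, for every $x\in A$, $\{N(A_i,x) : i\in I\}$ has property $(G_\eta)$; (iv) $\{A_i : i\in I\}$ has the CHIP and there is $\gamma>0$ such that, for every $x\in A$, $\{T(A_i,x) : i\in I\}$ has the linear regularity property with the same constant $\gamma$.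 -/

import Mathlib

open scoped Pointwise Topology

universe u v

namespace ConvexSystem

variable {X : Type u} [NormedAddCommGroup X] [NormedSpace ℝ X] {I : Type v}

/-- The tangent cone `T(A, x)`: the norm closure of the convex cone (closed under addition and under
multiplication by nonnegative reals) generated by `A - x`. -/
def tangentCone (A : Set X) (x : X) : Set X :=
  closure (PointedCone.hull ℝ (A - {x}) : Set X)

/-- The dual cone (negative polar) of a set: all continuous linear functionals that are
nonpositive on it. -/
def dualCone (S : Set X) : Set (StrongDual ℝ X) :=
  {f | ∀ y ∈ S, f y ≤ 0}

/-- The normal cone `N(A, x)`, the dual cone of `A - x`. -/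
def normalCone (A : Set X) (x : X) : Set (StrongDual ℝ X) :=
  dualCone (A - {x})

/-- The conical hull intersection property: at every point of the intersection, the tangent cone
to the intersection is the intersection of the tangent cones. -/
def CHIP (A : I → Set X) : Prop :=
  ∀ x ∈ ⋂ i, A i, tangentCone (⋂ i, A i) x = ⋂ i, tangentCone (A i) x

/-- The normal property with constant `η`, where `B` is the closed unit ball:
`⋂ i, (A i + η B) ⊆ (⋂ i, A i) + B`. -/
def NormalPropertyWith (A : I → Set X) (η : ℝ) : Prop :=
  (⋂ i, (A i + η • Metric.closedBall (0 : X) 1)) ⊆ (⋂ i, A i) + Metric.closedBall (0 : X) 1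

/-- Linear regularity with constant `γ`: `d(x, ⋂ i, A i) ≤ γ * sup_i d(x, A i)` for all `x`.
It is used for systems with nonempty intersection; then all the distances `d(x, A i)` are bounded by
`d(x, ⋂ i, A i)`, so that the supremum is a true supremum of real numbers. -/
def LinearRegularityWith (A : I → Set X) (γ : ℝ) : Prop :=
  ∀ x : X, Metric.infDist x (⋂ i, A i) ≤ γ * ⨆ i, Metric.infDist x (A i)

/-- The sum `∑ i, P i` of an arbitrary system of sets: all sums over nonempty finite sets of
indices of elements of the respective sets. -/
def sumSet {E : Type*} [AddCommMonoid E] (P : I → Set E) : Set E :=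
  {s | ∃ J : Finset I, J.Nonempty ∧ ∃ c : I → E, (∀ i ∈ J, c i ∈ P i) ∧ s = ∑ i ∈ J, c i}

/-- The (extended) property `(G_η)` of a system of sets `P i` in the dual of `X`: every `f` in the
weak-star closure of `∑ i, P i` is the weak-star limit of a net of finite sums `∑ i ∈ J k, y k i`
with `y k i ∈ P i` for `i ∈ J k` and `∑ i ∈ J k, ‖y k i‖ ≤ (1 / η) * ‖f‖`.
The directed index set `κ` of the net lives in the universe of `X`; this is no restriction, since
the weak-star neighbourhoods of `f` can always serve as index set. -/
def PropertyG (P : I → Set (StrongDual ℝ X)) (η : ℝ) : Prop :=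
  ∀ f : StrongDual ℝ X,
    StrongDual.toWeakDual f ∈ closure (StrongDual.toWeakDual '' sumSet P) →
      ∃ (κ : Type u) (_ : Preorder κ) (_ : IsDirectedOrder κ) (_ : Nonempty κ)
        (J : κ → Finset I) (y : κ → I → StrongDual ℝ X),
        (∀ k, ∀ i ∈ J k, y k i ∈ P i) ∧
        Filter.Tendsto (fun k => StrongDual.toWeakDual (∑ i ∈ J k, y k i)) Filter.atTop
          (𝓝 (StrongDual.toWeakDual f)) ∧
        ∀ k, ∑ i ∈ J k, ‖y k i‖ ≤ 1 / η * ‖f‖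

end ConvexSystem

namespace ConvexSystem

/-! Statement (iv), CHIP together with uniform linear regularity of the tangent cones, is the hub:
each of the other three is shown equivalent to it. (i) ⇒ (iv): linear regularity is applied at `x +
t • v` and divided by `t`. Lower semicontinuity and compactness of `I` give one small `t` that
serves all indices (`LinearRegularityWith.infDist_tangentCone_le`); a `v` in every `T(A_i, x)` then
has distance zero to `T(A, x)`, which is CHIP. (iv) ⇒ (i): distances to `A` need not be attained,
but Ekeland's principle gives a point `a` of `A` for which `d(x - a, T(A, a))` is almost `d(x, A)`;
moreover `d(x - a, T(A_i, a)) ≤ d(x, A_i)`. (ii) ⇔ (iv): the distance to a cone is positively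
homogeneous, so an inclusion at one scale is an inequality at all scales. (iii) ⇔ (iv): normal cones
are the polars of tangent cones, and `d(y, C)` is the maximum of `f y` over `f` in the polar of `C`
with `‖f‖ ≤ 1`. Weak-star separation turns the bound on distances into the bound on norms in
`(G_η)`. -/

/-- **Ekeland's variational principle** (existence of an approximate minimizer). -/
theorem exists_forall_le_add_mul_dist {α : Type*} [MetricSpace α] [CompleteSpace α] [Nonempty α]
    {φ : α → ℝ} (hφ : LowerSemicontinuous φ) (hb : BddBelow (Set.range φ)) {ε : ℝ} (hε : 0 < ε) :
    ∃ a, ∀ w, φ a ≤ φ w + ε * dist a w := by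
  let S : α → Set α := fun p => {w | φ w + ε * dist p w ≤ φ p}
  have hSself : ∀ p, p ∈ S p := fun p => by simp [S]
  have hStrans : ∀ {p q r}, q ∈ S p → r ∈ S q → r ∈ S p := by
    intro p q r hq hr
    simp only [S, Set.mem_ofPred_eq] at *
    nlinarith [dist_triangle p q r]
  have hSclosed : ∀ p, IsClosed (S p) := fun p => by
    have : LowerSemicontinuous fun w => φ w + ε * dist p w :=
      hφ.add (by fun_prop : Continuous fun w => ε * dist p w).lowerSemicontinuous
    exact this.isClosed_preimage (φ p)
  have hstep : ∀ p (δ : ℝ), 0 < δ → ∃ q ∈ S p, ∀ w ∈ S p, φ q ≤ φ w + δ := by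
    intro p δ hδ
    have hne : (φ '' S p).Nonempty := ⟨_, p, hSself p, rfl⟩
    have hbd : BddBelow (φ '' S p) := hb.mono (Set.image_subset_range _ _)
    obtain ⟨_, ⟨q, hq, rfl⟩, hlt⟩ := exists_lt_of_csInf_lt hne (lt_add_of_pos_right _ hδ)
    refine ⟨q, hq, fun w hw => ?_⟩
    have := csInf_le hbd ⟨w, hw, rfl⟩
    linarith
  choose! next hnext hnext' using hstep
  let s : ℕ → α := fun n =>
    Nat.rec (Classical.arbitrary α) (fun n p => next p (1 / ((n : ℝ) + 1))) n
  have hpos : ∀ n : ℕ, (0 : ℝ) < 1 / ((n : ℝ) + 1) := fun n => by positivity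
  have hs : ∀ n, s (n + 1) ∈ S (s n) := fun n => hnext _ _ (hpos n)
  have hs' : ∀ n, ∀ w ∈ S (s n), φ (s (n + 1)) ≤ φ w + 1 / ((n : ℝ) + 1) :=
    fun n => hnext' _ _ (hpos n)
  obtain ⟨m, hm⟩ := hb
  -- The steps are summable because `ε` times their total telescopes against the decrease of `φ`;
  -- the slack `1 / (n + 1)` plays no role here.
  have hsum : Summable fun n => dist (s n) (s (n + 1)) := by
    refine summable_of_sum_range_le (c := (φ (s 0) - m) / ε) (fun _ => dist_nonneg) fun n => ?_
    rw [le_div_iff₀ hε]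
    have : ∀ n, (∑ i ∈ Finset.range n, dist (s i) (s (i + 1))) * ε ≤ φ (s 0) - φ (s n) := by
      intro n
      induction n with
      | zero => simp
      | succ n ih =>
        rw [Finset.sum_range_succ]
        have := hs n
        simp only [S, Set.mem_ofPred_eq] at this
        linarith
    linarith [this n, hm ⟨s n, rfl⟩]
  obtain ⟨a, ha⟩ := cauchySeq_tendsto_of_complete (cauchySeq_of_summable_dist hsum)
  have hmem : ∀ n k, s (n + k) ∈ S (s n) := by
    intro n k
    induction k with
    | zero => exact hSself _
    | succ k ih => exact hStrans ih (hs _)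
  have haS : ∀ n, a ∈ S (s n) := fun n =>
    (hSclosed _).mem_of_tendsto ha <| (Filter.eventually_ge_atTop n).mono fun k hk => by
      obtain ⟨j, rfl⟩ := Nat.exists_eq_add_of_le hk
      exact hmem n j
  -- Each `w ∈ S a` lies in every `S (s n)`, where `s (n + 1)` is minimal up to `1 / (n + 1)`, and
  -- `φ a ≤ φ (s (n + 1))`.
  have hmin : ∀ w ∈ S a, φ a ≤ φ w := fun w hw => by
    have h : ∀ n : ℕ, φ a ≤ φ w + 1 / ((n : ℝ) + 1) := fun n => by
      have h1 := hs' n w (hStrans (haS n) hw)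
      have h2 : φ a + ε * dist (s (n + 1)) a ≤ φ (s (n + 1)) := haS (n + 1)
      have h3 : 0 ≤ ε * dist (s (n + 1)) a := by positivity
      linarith
    have hlim : Filter.Tendsto (fun n : ℕ => φ w + 1 / ((n : ℝ) + 1)) Filter.atTop (𝓝 (φ w + 0)) :=
      tendsto_const_nhds.add tendsto_one_div_add_atTop_nhds_zero_nat
    simpa using ge_of_tendsto' hlim h
  refine ⟨a, fun w => ?_⟩
  by_contra! hlt
  have := hmin w hlt.le
  have h3 : 0 ≤ ε * dist a w := by positivity
  linarith

/-! ### Normal property versus linear regularity, by scaling. -/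

section Cone

variable {X : Type u} [NormedAddCommGroup X] [NormedSpace ℝ X] {I : Type v}

theorem infDist_smul_cone (C : PointedCone ℝ X) {c : ℝ} (hc : 0 < c) (x : X) :
    Metric.infDist (c • x) C = c * Metric.infDist x C := by
  have hC : c • (C : Set X) = C := by
    ext y
    rw [Set.mem_smul_set_iff_inv_smul_mem₀ hc.ne']
    refine ⟨fun h => ?_, fun h => C.smul_mem (by positivity) h⟩
    have := C.smul_mem hc.le h
    rwa [smul_inv_smul₀ hc.ne'] at this
  conv_lhs => rw [← hC]
  rw [infDist_smul₀ hc.ne', Real.norm_of_nonneg hc.le]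

theorem bddAbove_infDist_cone (C : I → PointedCone ℝ X) (x : X) :
    BddAbove (Set.range fun i => Metric.infDist x (C i : Set X)) :=
  ⟨‖x‖, by
    rintro _ ⟨i, rfl⟩
    simpa using Metric.infDist_le_dist_of_mem (x := x) (C i).zero_mem⟩

omit [NormedSpace ℝ X] in
theorem bddAbove_infDist {A : I → Set X} (hne : (⋂ i, A i).Nonempty) (x : X) :
    BddAbove (Set.range fun i => Metric.infDist x (A i)) := by
  obtain ⟨a, ha⟩ := hne
  refine ⟨dist x a, ?_⟩
  rintro _ ⟨i, rfl⟩
  exact Metric.infDist_le_dist_of_mem (Set.mem_iInter.1 ha i)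

/-- The strict inequality `γ * η < 1` leaves room to choose a point at distance less than `1`, as
nearest points may not exist. -/
theorem LinearRegularityWith.normalPropertyWith [Nonempty I] {C : I → Set X}
    (hne : (⋂ i, C i).Nonempty) {γ η : ℝ} (hγ : 0 < γ) (hη : 0 < η)
    (hγη : γ * η < 1)
    (h : LinearRegularityWith C γ) : NormalPropertyWith C η := by
  intro y hy
  have hle : ∀ i, Metric.infDist y (C i) ≤ η := fun i => by
    obtain ⟨c, hc, b, hb, rfl⟩ := Set.mem_iInter.1 hy i
    obtain ⟨b, hb, rfl⟩ := hb
    refine (Metric.infDist_le_dist_of_mem hc).trans ?_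
    simp only [mem_closedBall_zero_iff] at hb
    simpa [norm_smul, abs_of_pos hη] using mul_le_of_le_one_right hη.le hb
  have hlt : Metric.infDist y (⋂ i, C i) < 1 :=
    ((h y).trans (mul_le_mul_of_nonneg_left (ciSup_le hle) hγ.le)).trans_lt hγη
  obtain ⟨c, hc, hd⟩ := (Metric.infDist_lt_iff hne).1 hlt
  exact ⟨c, hc, y - c, by simpa [← dist_eq_norm] using hd.le, by simp⟩

theorem NormalPropertyWith.linearRegularityWith (C : I → PointedCone ℝ X) {η : ℝ} (hη : 0 < η)
    (h : NormalPropertyWith (fun i => (C i : Set X)) η) :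
    LinearRegularityWith (fun i => (C i : Set X)) (1 / η) := by
  intro x
  set M := ⨆ i, Metric.infDist x (C i : Set X) with hM
  have hM0 : 0 ≤ M := Real.iSup_nonneg fun i => Metric.infDist_nonneg
  have hcoe : (⋂ i, (C i : Set X)) = ((⨅ i, C i : PointedCone ℝ X) : Set X) := by simp
  have key : ∀ s, M < s → Metric.infDist x (⋂ i, (C i : Set X)) ≤ 1 / η * s := by
    intro s hs
    have hs0 : 0 < s := hM0.trans_lt hs
    -- The factor `η / s` brings all distances to the `C i` strictly below `η`.
    have hmem : (η / s) • x ∈ ⋂ i, ((C i : Set X) + η • Metric.closedBall (0 : X) 1) := by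
      refine Set.mem_iInter.2 fun i => ?_
      have h1 : Metric.infDist ((η / s) • x) (C i : Set X) < η := by
        rw [infDist_smul_cone _ (by positivity)]
        have := le_ciSup (bddAbove_infDist_cone C x) i
        have h2 : Metric.infDist x (C i : Set X) < s := this.trans_lt hs
        calc _ < η / s * s := by gcongr
          _ = η := by field_simp
      obtain ⟨c, hc, hd⟩ := (Metric.infDist_lt_iff (C i).nonempty).1 h1
      refine ⟨c, hc, (η / s) • x - c, ?_, by simp⟩
      rw [smul_unitClosedBall_of_nonneg hη.le]
      simpa [← dist_eq_norm] using hd.le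
    obtain ⟨c, hc, b, hb, hcb⟩ := h hmem
    have h3 : Metric.infDist ((η / s) • x) (⋂ i, (C i : Set X)) ≤ 1 := by
      refine (Metric.infDist_le_dist_of_mem hc).trans ?_
      rw [← hcb]
      simpa using hb
    rw [hcoe, infDist_smul_cone _ (by positivity), ← hcoe] at h3
    calc _ = 1 / η * s * (η / s * Metric.infDist x (⋂ i, (C i : Set X))) := by field_simp
      _ ≤ 1 / η * s * 1 := by gcongr
      _ = _ := mul_one _
  have h4 : ∀ δ > 0, Metric.infDist x (⋂ i, (C i : Set X)) ≤ 1 / η * M + δ := fun δ hδ => by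
    have := key (M + η * δ) (by nlinarith)
    calc _ ≤ _ := this
      _ = _ := by field_simp
  exact le_of_forall_pos_le_add h4

end Cone

/-! ### Linear regularity versus tangent cones. -/

section TangentCone

variable {X : Type u} [NormedAddCommGroup X] [NormedSpace ℝ X] {I : Type v}

/-- The tangent cone as a pointed cone. -/
def tangentPointedCone (A : Set X) (x : X) : PointedCone ℝ X :=
  (PointedCone.hull ℝ (A - {x})).closure

theorem isClosed_tangentCone (A : Set X) (x : X) : IsClosed (tangentCone A x) := isClosed_closure

theorem tangentCone_mono {A B : Set X} (h : A ⊆ B) (x : X) : tangentCone A x ⊆ tangentCone B x :=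
  closure_mono (Submodule.span_mono (Set.sub_subset_sub_right h))

theorem smul_sub_mem_tangentCone {A : Set X} {a x : X} (ha : a ∈ A) {r : ℝ} (hr : 0 ≤ r) :
    r • (a - x) ∈ tangentCone A x :=
  subset_closure <| PointedCone.smul_mem _ hr <|
    PointedCone.subset_hull <| Set.sub_mem_sub ha (Set.mem_singleton x)

theorem exists_forall_add_smul_mem_of_mem_hull {A : Set X} (hA : Convex ℝ A) {x : X} (hx : x ∈ A)
    {v : X} (hv : v ∈ PointedCone.hull ℝ (A - {x})) :
    ∃ t : ℝ, 0 < t ∧ ∀ s ∈ Set.Icc 0 t, x + s • v ∈ A := by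
  induction hv using Submodule.span_induction with
  | mem v hv =>
    obtain ⟨a, ha, y, rfl, rfl⟩ := hv
    refine ⟨1, one_pos, fun s hs => ?_⟩
    exact hA.add_smul_sub_mem hx ha hs
  | zero => exact ⟨1, one_pos, fun s _ => by simpa⟩
  | add v w _ _ ihv ihw =>
    obtain ⟨t₁, ht₁, h₁⟩ := ihv
    obtain ⟨t₂, ht₂, h₂⟩ := ihw
    refine ⟨min t₁ t₂ / 2, by positivity, fun s hs => ?_⟩
    have hs₁ : 2 * s ≤ t₁ := by linarith [hs.2, min_le_left t₁ t₂]
    have hs₂ : 2 * s ≤ t₂ := by linarith [hs.2, min_le_right t₁ t₂]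
    -- `x + s • (v + w)` is the midpoint of `x + (2 * s) • v` and `x + (2 * s) • w`.
    have := hA (h₁ (2 * s) ⟨by linarith [hs.1], hs₁⟩) (h₂ (2 * s) ⟨by linarith [hs.1], hs₂⟩)
      (a := 1 / 2) (b := 1 / 2) (by norm_num) (by norm_num) (by norm_num)
    convert this using 1
    module
  | smul r v _ ih =>
    obtain ⟨t, ht, h⟩ := ih
    obtain ⟨r, hr⟩ := r
    refine ⟨t / (r + 1), by positivity, fun s hs => ?_⟩
    rw [Nonneg.mk_smul, smul_smul]
    refine h _ ⟨mul_nonneg hs.1 hr, ?_⟩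
    have := (le_div_iff₀ (by positivity)).1 hs.2
    nlinarith [hs.1]

theorem dualCone_tangentCone (A : Set X) (x : X) : dualCone (tangentCone A x) = normalCone A x := by
  refine Set.Subset.antisymm (fun f hf y hy => hf y (subset_closure (PointedCone.subset_hull hy)))
    fun f hf y hy => ?_
  have hcl : IsClosed {y | f y ≤ 0} := isClosed_le f.continuous continuous_const
  refine closure_minimal (fun y hy => ?_) hcl hy
  induction hy using Submodule.span_induction with
  | mem v hv => exact hf v hv
  | zero => simp
  | add v w _ _ ihv ihw =>
    simp only [Set.mem_ofPred_eq, map_add] at *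
    linarith
  | smul r v _ ih =>
    obtain ⟨r, hr⟩ := r
    simp only [Set.mem_ofPred_eq, Nonneg.mk_smul, map_smul, smul_eq_mul] at *
    exact mul_nonpos_of_nonneg_of_nonpos hr ih

/-- The distance to the tangent cones of a linearly regular system: a compactness argument of Dini
type makes the distances to the rescaled sets converge uniformly. -/
theorem LinearRegularityWith.infDist_tangentCone_le [Nonempty I] [TopologicalSpace I]
    [CompactSpace I] {A : I → Set X} (hconvex : ∀ i, Convex ℝ (A i)) (hlsc : LowerHemicontinuous A)
    {γ : ℝ} (hγ : 0 < γ) (h : LinearRegularityWith A γ) {x : X} (hx : x ∈ ⋂ i, A i) (v : X) :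
    Metric.infDist v (tangentCone (⋂ i, A i) x) ≤
      γ * ⨆ i, Metric.infDist v (tangentCone (A i) x) := by
  have hxi := Set.mem_iInter.1 hx
  have key : ∀ σ, (⨆ i, Metric.infDist v (tangentCone (A i) x)) < σ →
      Metric.infDist v (tangentCone (⋂ i, A i) x) ≤ γ * σ := by
    intro σ hσ
    have hσi : ∀ i, Metric.infDist v (tangentCone (A i) x) < σ := fun i =>
      (le_ciSup (bddAbove_infDist_cone (fun i => tangentPointedCone (A i) x) v) i).trans_lt hσ
    have hσ0 : 0 < σ := Metric.infDist_nonneg.trans_lt (hσi (Classical.arbitrary I))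
    -- Asking for the bound at every `s ≤ t` makes the property stable under finite unions of index
    -- sets, by taking the smaller `t`. Near one index, lower semicontinuity gives it at `s = t`,
    -- and convexity with `x ∈ A j` carries it down to smaller `s`.
    obtain ⟨t, ht, hle⟩ : ∃ t > 0, ∀ s ∈ Set.Ioc 0 t, ∀ j ∈ (Set.univ : Set I),
        Metric.infDist (x + s • v) (A j) ≤ s * σ := by
      refine isCompact_univ.induction_on (p := fun U : Set I => ∃ t > 0, ∀ s ∈ Set.Ioc (0 : ℝ) t,
        ∀ j ∈ U, Metric.infDist (x + s • v) (A j) ≤ s * σ) ⟨1, one_pos, by simp⟩ ?_ ?_ ?_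
      · rintro U V hUV ⟨t, ht, h⟩
        exact ⟨t, ht, fun s hs j hj => h s hs j (hUV hj)⟩
      · rintro U V ⟨t₁, ht₁, h₁⟩ ⟨t₂, ht₂, h₂⟩
        refine ⟨min t₁ t₂, lt_min ht₁ ht₂, fun s hs j hj => ?_⟩
        rcases hj with hj | hj
        · exact h₁ s ⟨hs.1, hs.2.trans (min_le_left _ _)⟩ j hj
        · exact h₂ s ⟨hs.1, hs.2.trans (min_le_right _ _)⟩ j hj
      · intro i _
        have h1 := hσi i
        rw [tangentCone, Metric.infDist_closure] at h1
        obtain ⟨w, hw, hd⟩ := (Metric.infDist_lt_iff (Submodule.nonempty _)).1 h1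
        obtain ⟨t, ht, htw⟩ := exists_forall_add_smul_mem_of_mem_hull (hconvex i) (hxi i) hw
        have hmem : x + t • w ∈ Metric.ball (x + t • v) (t * σ) := by
          rw [Metric.mem_ball, dist_add_left, dist_smul₀, Real.norm_of_nonneg ht.le, dist_comm]
          gcongr
        have hev := lowerHemicontinuousAt_iff.1 (hlsc i) _ Metric.isOpen_ball
          ⟨_, htw t ⟨ht.le, le_rfl⟩, hmem⟩
        refine ⟨_, mem_nhdsWithin_of_mem_nhds hev, t, ht, fun s hs j hj => ?_⟩
        obtain ⟨z, hz, hzd⟩ := hj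
        have hs1 : s / t ≤ 1 := (div_le_one ht).2 hs.2
        have hs0 : 0 < s / t := div_pos hs.1 ht
        refine (Metric.infDist_le_dist_of_mem
          ((hconvex j).add_smul_sub_mem (hxi j) hz ⟨hs0.le, hs1⟩)).trans ?_
        have heq : s • v = (s / t) • (t • v) := by
          rw [smul_smul, div_mul_cancel₀ _ ht.ne']
        have hzd' : dist (t • v) (z - x) < t * σ := by
          rw [Metric.mem_ball, dist_comm] at hzd
          rwa [← dist_add_left x, add_sub_cancel]
        rw [dist_add_left, heq, dist_smul₀, Real.norm_of_nonneg hs0.le]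
        calc _ ≤ s / t * (t * σ) := by gcongr
          _ = s * σ := by field_simp
    have hA : Metric.infDist (x + t • v) (⋂ i, A i) ≤ γ * (t * σ) :=
      (h _).trans <| mul_le_mul_of_nonneg_left
        (ciSup_le fun j => hle t ⟨ht, le_rfl⟩ j (Set.mem_univ j)) hγ.le
    refine le_of_forall_gt fun ρ hρ => ?_
    obtain ⟨a, ha, hd⟩ := (Metric.infDist_lt_iff (r := t * ρ) ⟨x, hx⟩).1
      (hA.trans_lt (by nlinarith [mul_lt_mul_of_pos_left hρ ht]))
    refine (Metric.infDist_le_dist_of_mem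
      (smul_sub_mem_tangentCone (x := x) ha (inv_nonneg.2 ht.le))).trans_lt ?_
    have h2 : dist v (t⁻¹ • (a - x)) = t⁻¹ * dist (x + t • v) a := by
      rw [← inv_smul_smul₀ ht.ne' v, dist_smul₀, Real.norm_of_nonneg (inv_nonneg.2 ht.le),
        smul_inv_smul₀ ht.ne', ← dist_add_left x, add_sub_cancel]
    rw [h2]
    calc _ < t⁻¹ * (t * ρ) := by gcongr
      _ = ρ := by field_simp
  refine le_of_forall_pos_le_add fun δ hδ => ?_
  have := key ((⨆ i, Metric.infDist v (tangentCone (A i) x)) + δ / γ)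
    (lt_add_of_pos_right _ (by positivity))
  calc _ ≤ _ := this
    _ = _ := by field_simp

theorem iInter_tangentCone_subset (A : I → Set X) (x : X) :
    tangentCone (⋂ i, A i) x ⊆ ⋂ i, tangentCone (A i) x :=
  Set.subset_iInter fun i => tangentCone_mono (Set.iInter_subset _ i) x

theorem LinearRegularityWith.chip [Nonempty I] [TopologicalSpace I]
    [CompactSpace I] {A : I → Set X} (hconvex : ∀ i, Convex ℝ (A i)) (hlsc : LowerHemicontinuous A)
    {γ : ℝ} (hγ : 0 < γ) (h : LinearRegularityWith A γ) : CHIP A := by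
  intro x hx
  refine (iInter_tangentCone_subset A x).antisymm fun v hv => ?_
  have hne : (tangentCone (⋂ i, A i) x).Nonempty := (tangentPointedCone (⋂ i, A i) x).nonempty
  rw [(isClosed_tangentCone _ x).mem_iff_infDist_zero hne]
  refine le_antisymm ?_ Metric.infDist_nonneg
  have := h.infDist_tangentCone_le hconvex hlsc hγ hx v
  simpa [fun i => Metric.infDist_zero_of_mem (Set.mem_iInter.1 hv i)] using this

/-- At an Ekeland point `a` of the distance to `x` on `A`, the distance from `x - a` to the tangent
cone is almost that from `x` to `A`. -/
theorem exists_mul_infDist_le_infDist_tangentCone [CompleteSpace X] {A : Set X} (hA : IsClosed A)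
    (hconvex : Convex ℝ A) (hne : A.Nonempty) (x : X) {ε : ℝ} (hε : 0 < ε) (hε1 : ε ≤ 1) :
    ∃ a ∈ A, (1 - ε) * Metric.infDist x A ≤ Metric.infDist (x - a) (tangentCone A a) := by
  have := hA.completeSpace_coe
  have := hne.to_subtype
  obtain ⟨⟨a, ha⟩, hmin⟩ := exists_forall_le_add_mul_dist (α := A) (φ := fun u => dist x u)
    (by fun_prop : Continuous fun u : A => dist x u).lowerSemicontinuous
    ⟨0, by rintro _ ⟨u, rfl⟩; exact dist_nonneg⟩ (half_pos hε)
  refine ⟨a, ha, ?_⟩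
  rw [tangentCone, Metric.infDist_closure, Metric.le_infDist (Submodule.nonempty _)]
  intro w hw
  obtain ⟨t, ht, htw⟩ := exists_forall_add_smul_mem_of_mem_hull hconvex ha hw
  have hd : Metric.infDist x A ≤ ‖x - a‖ := by
    rw [← dist_eq_norm]; exact Metric.infDist_le_dist_of_mem ha
  have hkey : ‖x - a‖ ≤ ‖x - a - w‖ + ε / 2 * ‖w‖ := by
    set s := min t 1 with hs
    have hs0 : 0 < s := lt_min ht one_pos
    have hs1 : s ≤ 1 := min_le_right _ _
    have h1 := hmin ⟨a + s • w, htw s ⟨hs0.le, min_le_left _ _⟩⟩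
    simp only [Subtype.dist_eq, dist_self_add_right, norm_smul, Real.norm_of_nonneg hs0.le]
      at h1
    rw [dist_eq_norm, dist_eq_norm] at h1
    -- Convexity of the norm turns minimality on a short segment into an estimate for the full `w`.
    have h2 : ‖x - (a + s • w)‖ ≤ (1 - s) * ‖x - a‖ + s * ‖x - a - w‖ := by
      have : x - (a + s • w) = (1 - s) • (x - a) + s • (x - a - w) := by module
      rw [this]
      refine (norm_add_le _ _).trans_eq ?_
      rw [norm_smul, norm_smul, Real.norm_of_nonneg hs0.le,
        Real.norm_of_nonneg (sub_nonneg.2 hs1)]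
    have h3 : s * ‖x - a‖ ≤ s * (‖x - a - w‖ + ε / 2 * ‖w‖) := by linarith
    exact le_of_mul_le_mul_left h3 hs0
  rw [dist_eq_norm]
  have h4 : (1 - ε) * Metric.infDist x A ≤ (1 - ε) * ‖x - a‖ :=
    mul_le_mul_of_nonneg_left hd (sub_nonneg.2 hε1)
  have h5 : ‖w‖ - ‖x - a‖ ≤ ‖x - a - w‖ := by
    rw [norm_sub_rev (x - a)]; exact norm_sub_norm_le _ _
  have h6 := norm_nonneg (x - a)
  -- For short `w` the penalty `ε / 2 * ‖w‖` is at most `ε * ‖x - a‖`; for long `w` the triangle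
  -- inequality already gives `‖x - a‖ ≤ ‖x - a - w‖`.
  rcases le_total ‖w‖ (2 * ‖x - a‖) with h | h
  · nlinarith
  · nlinarith

/-- At an Ekeland point `a`, CHIP replaces `T(A, a)` by the intersection of the `T(A_i, a)`. As `A_i
- a ⊆ T(A_i, a)`, passing to the cones only decreases the distances on the right. -/
theorem linearRegularityWith_of_tangentCone [Nonempty I] [CompleteSpace X] {A : I → Set X}
    (hclosed : ∀ i, IsClosed (A i)) (hconvex : ∀ i, Convex ℝ (A i)) (hne : (⋂ i, A i).Nonempty)
    (hchip : CHIP A) {γ : ℝ} (hγ : 0 < γ)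
    (h : ∀ x ∈ ⋂ i, A i, LinearRegularityWith (fun i => tangentCone (A i) x) γ) :
    LinearRegularityWith A γ := by
  intro x
  set M := γ * ⨆ i, Metric.infDist x (A i)
  have key : ∀ ε, 0 < ε → ε ≤ 1 → (1 - ε) * Metric.infDist x (⋂ i, A i) ≤ M := by
    intro ε hε hε1
    obtain ⟨a, ha, hle⟩ := exists_mul_infDist_le_infDist_tangentCone (isClosed_iInter hclosed)
      (convex_iInter hconvex) hne x hε hε1
    refine hle.trans ?_
    rw [hchip a ha]
    refine (h a ha (x - a)).trans (mul_le_mul_of_nonneg_left ?_ hγ.le)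
    refine ciSup_le fun i => le_trans ?_ (le_ciSup (bddAbove_infDist hne x) i)
    rw [Metric.le_infDist ⟨a, Set.mem_iInter.1 ha i⟩]
    intro y hy
    have := Metric.infDist_le_dist_of_mem (x := x - a)
      (smul_sub_mem_tangentCone (x := a) hy zero_le_one)
    simpa using this
  have hlim : Filter.Tendsto (fun n : ℕ => (1 - 1 / ((n : ℝ) + 1)) * Metric.infDist x (⋂ i, A i))
      Filter.atTop (𝓝 ((1 - 0) * Metric.infDist x (⋂ i, A i))) :=
    (tendsto_const_nhds.sub tendsto_one_div_add_atTop_nhds_zero_nat).mul_const _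
  simp only [sub_zero, one_mul] at hlim
  refine le_of_tendsto' hlim fun n => key _ (by positivity) ?_
  rw [div_le_one (by positivity)]
  simp

end TangentCone

/-! ### Polar cones, weak-star separation and property `(G_η)`. -/

section Duality

variable {X : Type u} [NormedAddCommGroup X] [NormedSpace ℝ X] {I : Type v}

/-- A point of the closure of a set is the limit of a net in the set, indexed by the
neighbourhoods of the point. -/
theorem exists_net_of_mem_closure {E : Type u} [TopologicalSpace E] {S : Set E} {x : E}
    (hx : x ∈ closure S) :
    ∃ (κ : Type u) (_ : Preorder κ) (_ : IsDirectedOrder κ) (_ : Nonempty κ) (g : κ → E),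
      (∀ k, g k ∈ S) ∧ Filter.Tendsto g Filter.atTop (𝓝 x) := by
  have hex : ∀ k : {U : Set E // U ∈ 𝓝 x}ᵒᵈ, ∃ y, y ∈ (OrderDual.ofDual k).1 ∧ y ∈ S :=
    fun k => mem_closure_iff_nhds.1 hx _ (OrderDual.ofDual k).2
  choose g hgU hgS using hex
  refine ⟨{U : Set E // U ∈ 𝓝 x}ᵒᵈ, inferInstance, ⟨fun U V => ?_⟩,
    ⟨OrderDual.toDual ⟨Set.univ, Filter.univ_mem⟩⟩, g, hgS, ?_⟩
  · exact ⟨OrderDual.toDual ⟨_, Filter.inter_mem (OrderDual.ofDual U).2 (OrderDual.ofDual V).2⟩,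
      Set.inter_subset_left, Set.inter_subset_right⟩
  · intro U hU
    let k₀ : {U : Set E // U ∈ 𝓝 x}ᵒᵈ := OrderDual.toDual ⟨U, hU⟩
    exact Filter.mem_map.2 <| Filter.mem_of_superset (Filter.mem_atTop k₀)
      fun k (hk : k₀ ≤ k) => hk (hgU k)

/-- Weak-star continuous functionals are evaluations, so the separating functional is a point of
`X`. -/
theorem exists_lt_of_notMem_closure_weakDual {S : Set (WeakDual ℝ X)} (hS : Convex ℝ S)
    {f : WeakDual ℝ X} (hf : f ∉ closure S) :
    ∃ (y : X) (u : ℝ), (∀ g ∈ S, g y < u) ∧ u < f y := by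
  have : LocallyConvexSpace ℝ (WeakDual ℝ X) :=
    inferInstanceAs (LocallyConvexSpace ℝ (WeakBilin (topDualPairing ℝ X)))
  obtain ⟨φ, u, hφ, hu⟩ := geometric_hahn_banach_closed_point hS.closure isClosed_closure hf
  obtain ⟨y, hy⟩ := LinearMap.dualEmbedding_surjective (topDualPairing ℝ X) φ
  have hφy : ∀ g : WeakDual ℝ X, φ g = g y := fun g => (DFunLike.congr_fun hy g).symm
  exact ⟨y, u, fun g hg => hφy g ▸ hφ g (subset_closure hg), hφy f ▸ hu⟩

theorem apply_le_of_mem_dualCone (C : PointedCone ℝ X) {f : StrongDual ℝ X}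
    (hf : f ∈ dualCone (C : Set X)) (y : X) : f y ≤ ‖f‖ * Metric.infDist y C := by
  refine le_of_forall_pos_le_add fun δ hδ => ?_
  obtain ⟨c, hc, hd⟩ := (Metric.infDist_lt_iff C.nonempty).1
    (lt_add_of_pos_right (Metric.infDist y C) (div_pos hδ (by positivity : 0 < ‖f‖ + 1)))
  calc f y = f c + f (y - c) := by simp
    _ ≤ 0 + ‖f‖ * dist y c := by
      rw [dist_eq_norm]
      exact add_le_add (hf c hc) ((le_abs_self _).trans (f.le_opNorm _))
    _ ≤ ‖f‖ * (Metric.infDist y C + δ / (‖f‖ + 1)) := by rw [zero_add]; gcongr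
    _ = ‖f‖ * Metric.infDist y C + δ * (‖f‖ / (‖f‖ + 1)) := by ring
    _ ≤ ‖f‖ * Metric.infDist y C + δ := by
      gcongr
      refine mul_le_of_le_one_right hδ.le ?_
      rw [div_le_one (by positivity)]
      linarith

/-- The cone is separated from the open ball around `y` that just misses it; the normalized negative
of the separating functional is the required one. -/
theorem exists_mem_dualCone_infDist_le (C : PointedCone ℝ X) (y : X) :
    ∃ f ∈ dualCone (C : Set X), ‖f‖ ≤ 1 ∧ Metric.infDist y C ≤ f y := by
  rcases (Metric.infDist_nonneg (x := y) (s := C)).eq_or_lt with h0 | hpos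
  · exact ⟨0, fun _ _ => by simp, by simp, by simp [← h0]⟩
  set d := Metric.infDist y C
  have hdisj : Disjoint (Metric.ball y d) (C : Set X) := Metric.disjoint_ball_infDist
  obtain ⟨g, u, hg, hu⟩ := geometric_hahn_banach_open (convex_ball y d) Metric.isOpen_ball
    C.convex hdisj
  have hu0 : u ≤ 0 := by simpa using hu 0 C.zero_mem
  have hgC : ∀ c ∈ (C : Set X), 0 ≤ g c := by
    intro c hc
    by_contra! hneg
    have hmem := C.smul_mem (div_nonneg_of_nonpos (by linarith : u - 1 ≤ 0) hneg.le) hc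
    have := hu _ hmem
    rw [map_smul, smul_eq_mul, div_mul_cancel₀ _ hneg.ne] at this
    linarith
  have hgy : g y < 0 := (hg y (Metric.mem_ball_self hpos)).trans_le hu0
  have hnorm : ‖g‖ * d ≤ -g y := by
    rw [← le_div_iff₀ hpos]
    refine g.opNorm_le_of_unit_norm (div_nonneg (by linarith) hpos.le) fun z hz => ?_
    rw [Real.norm_eq_abs, le_div_iff₀ hpos]
    have hz' : ∀ z : X, ‖z‖ = 1 → g z * d ≤ - g y := by
      intro z hz
      by_contra! hlt
      -- Otherwise a move from `y` along `z`, shorter than `d`, would reach a zero of `g` inside the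
      -- ball, where `g < u ≤ 0`.
      have hgz : 0 < g z := by nlinarith
      have hmem : y + (-g y / g z) • z ∈ Metric.ball y d := by
        rw [mem_ball_iff_norm, add_sub_cancel_left, norm_smul, hz, mul_one,
          Real.norm_of_nonneg (div_nonneg (by linarith) hgz.le), div_lt_iff₀ hgz]
        linarith
      have := hg _ hmem
      rw [map_add, map_smul, smul_eq_mul, div_mul_cancel₀ _ hgz.ne'] at this
      linarith
    rcases abs_cases (g z) with h | h
    · rw [h.1]; exact hz' z hz
    · rw [h.1]; simpa using hz' (-z) (by simpa)
  have hg0 : 0 < ‖g‖ := norm_pos_iff.2 fun h => by simp [h] at hgy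
  refine ⟨-(‖g‖⁻¹ • g), fun c hc => ?_, ?_, ?_⟩
  · have := mul_nonneg (inv_nonneg.2 hg0.le) (hgC c hc)
    simpa using this
  · rw [norm_neg, norm_smul, norm_inv, norm_norm, inv_mul_cancel₀ hg0.ne']
  · have : d ≤ ‖g‖⁻¹ * (-g y) := by rw [le_inv_mul_iff₀ hg0]; exact hnorm
    simpa using this

theorem smul_mem_dualCone {S : Set X} {f : StrongDual ℝ X} (hf : f ∈ dualCone S) {r : ℝ}
    (hr : 0 ≤ r) : r • f ∈ dualCone S := fun y hy => by
  simpa using mul_nonpos_of_nonneg_of_nonpos hr (hf y hy)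

theorem add_mem_dualCone {S : Set X} {f g : StrongDual ℝ X} (hf : f ∈ dualCone S)
    (hg : g ∈ dualCone S) : f + g ∈ dualCone S := fun y hy => by
  simpa using add_nonpos (hf y hy) (hg y hy)

/-- Finite sums of elements of dual cones can be combined with nonnegative coefficients, with
control of the total norm. -/
theorem exists_sum_eq_smul_add_smul {S : I → Set X} {J₁ J₂ : Finset I} {p q : I → StrongDual ℝ X}
    (hp : ∀ i ∈ J₁, p i ∈ dualCone (S i)) (hq : ∀ i ∈ J₂, q i ∈ dualCone (S i)) {a b : ℝ}
    (ha : 0 ≤ a) (hb : 0 ≤ b) :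
    ∃ (J : Finset I) (r : I → StrongDual ℝ X), J₁ ⊆ J ∧ (∀ i ∈ J, r i ∈ dualCone (S i)) ∧
      ∑ i ∈ J, r i = a • ∑ i ∈ J₁, p i + b • ∑ i ∈ J₂, q i ∧
      ∑ i ∈ J, ‖r i‖ ≤ a * ∑ i ∈ J₁, ‖p i‖ + b * ∑ i ∈ J₂, ‖q i‖ := by
  classical
  let p' : I → StrongDual ℝ X := fun i => if i ∈ J₁ then p i else 0
  let q' : I → StrongDual ℝ X := fun i => if i ∈ J₂ then q i else 0
  have hp' : ∀ i, p' i ∈ dualCone (S i) := fun i => by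
    by_cases h : i ∈ J₁
    · simpa [p', h] using hp i h
    · simp [p', h, dualCone]
  have hq' : ∀ i, q' i ∈ dualCone (S i) := fun i => by
    by_cases h : i ∈ J₂
    · simpa [q', h] using hq i h
    · simp [q', h, dualCone]
  refine ⟨J₁ ∪ J₂, fun i => a • p' i + b • q' i, Finset.subset_union_left,
    fun i _ => add_mem_dualCone (smul_mem_dualCone (hp' i) ha) (smul_mem_dualCone (hq' i) hb),
    ?_, ?_⟩
  · rw [Finset.sum_add_distrib, ← Finset.smul_sum, ← Finset.smul_sum]
    simp [p', q', Finset.sum_ite_mem, Finset.union_inter_cancel_left,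
      Finset.union_inter_cancel_right]
  · have h1 : ∑ i ∈ J₁ ∪ J₂, ‖p' i‖ = ∑ i ∈ J₁, ‖p i‖ := by
      simp [p', apply_ite norm, Finset.sum_ite_mem, Finset.union_inter_cancel_left]
    have h2 : ∑ i ∈ J₁ ∪ J₂, ‖q' i‖ = ∑ i ∈ J₂, ‖q i‖ := by
      simp [q', apply_ite norm, Finset.sum_ite_mem, Finset.union_inter_cancel_right]
    rw [← h1, ← h2, Finset.mul_sum, Finset.mul_sum, ← Finset.sum_add_distrib]
    refine Finset.sum_le_sum fun i _ => (norm_add_le _ _).trans_eq ?_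
    rw [norm_smul, norm_smul, Real.norm_of_nonneg ha, Real.norm_of_nonneg hb]

theorem convex_sumSet_dualCone (S : I → Set X) : Convex ℝ (sumSet fun i => dualCone (S i)) := by
  rintro _ ⟨J₁, hJ₁, p, hp, rfl⟩ _ ⟨J₂, _, q, hq, rfl⟩ a b ha hb _
  obtain ⟨J, r, hJ, hr, hsum, _⟩ := exists_sum_eq_smul_add_smul hp hq ha hb
  exact ⟨J, hJ₁.mono hJ, r, hr, hsum.symm⟩

/-- The finite sums of elements of the dual cones with total norm at most `c`. -/
def boundedSumSet (S : I → Set X) (c : ℝ) : Set (StrongDual ℝ X) :=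
  {s | ∃ (J : Finset I) (p : I → StrongDual ℝ X), (∀ i ∈ J, p i ∈ dualCone (S i)) ∧
    ∑ i ∈ J, p i = s ∧ ∑ i ∈ J, ‖p i‖ ≤ c}

theorem convex_boundedSumSet (S : I → Set X) (c : ℝ) : Convex ℝ (boundedSumSet S c) := by
  rintro _ ⟨J₁, p, hp, rfl, hpc⟩ _ ⟨J₂, q, hq, rfl, hqc⟩ a b ha hb hab
  obtain ⟨J, r, _, hr, hsum, hle⟩ := exists_sum_eq_smul_add_smul hp hq ha hb
  refine ⟨J, r, hr, hsum, hle.trans ?_⟩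
  calc _ ≤ a * c + b * c := by gcongr
    _ = c := by rw [← add_mul, hab, one_mul]

/-- Bipolar argument: a separating `y` is nonpositive under each polar, since these are cones, hence
lies in every closed `C i`, where `f` cannot be positive. -/
theorem dualCone_iInter_subset_closure [Nonempty I] (C : I → PointedCone ℝ X)
    (hC : ∀ i, IsClosed (C i : Set X)) {f : StrongDual ℝ X}
    (hf : f ∈ dualCone (⋂ i, (C i : Set X))) :
    StrongDual.toWeakDual f ∈
      closure (StrongDual.toWeakDual '' sumSet fun i => dualCone (C i : Set X)) := by
  by_contra hnot
  obtain ⟨y, u, hu, hfu⟩ := exists_lt_of_notMem_closure_weakDual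
    ((convex_sumSet_dualCone fun i => (C i : Set X)).linear_image
      (StrongDual.toWeakDual (𝕜 := ℝ) (E := X)).toLinearMap) hnot
  have hsingle : ∀ i, ∀ g ∈ dualCone (C i : Set X), g y < u := fun i g hg =>
    hu _ ⟨g, ⟨{i}, Finset.singleton_nonempty i, fun _ => g, by simpa using hg, by simp⟩, rfl⟩
  have hu0 : 0 < u := by
    simpa using hsingle (Classical.arbitrary I) 0 fun _ _ => by simp
  have hle : ∀ i, ∀ g ∈ dualCone (C i : Set X), g y ≤ 0 := by
    intro i g hg
    by_contra! hpos
    have := hsingle i _ (smul_mem_dualCone hg (div_pos hu0 hpos).le)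
    simp [div_mul_cancel₀ _ hpos.ne'] at this
  have hy : y ∈ ⋂ i, (C i : Set X) := Set.mem_iInter.2 fun i => by
    obtain ⟨g, hg, _, hd⟩ := exists_mem_dualCone_infDist_le (C i) y
    rw [(hC i).mem_iff_infDist_zero (C i).nonempty]
    exact le_antisymm (hd.trans (hle i g hg)) Metric.infDist_nonneg
  have := hf y hy
  rw [StrongDual.toWeakDual_apply] at hfu
  linarith

theorem mem_dualCone_of_mem_closure (C : I → PointedCone ℝ X) {f : StrongDual ℝ X}
    (hf : StrongDual.toWeakDual f ∈
      closure (StrongDual.toWeakDual '' sumSet fun i => dualCone (C i : Set X))) :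
    f ∈ dualCone (⋂ i, (C i : Set X)) := by
  intro y hy
  have hcl : IsClosed {g : WeakDual ℝ X | g y ≤ 0} :=
    isClosed_le (WeakDual.eval_continuous y) continuous_const
  refine closure_minimal ?_ hcl hf
  rintro _ ⟨_, ⟨J, _, p, hp, rfl⟩, rfl⟩
  simp only [Set.mem_ofPred_eq, StrongDual.toWeakDual_apply, sum_apply]
  exact Finset.sum_nonpos fun i hi => hp i hi y (Set.mem_iInter.1 hy i)

theorem PropertyG.linearRegularityWith [Nonempty I] (C : I → PointedCone ℝ X)
    (hC : ∀ i, IsClosed (C i : Set X)) {η : ℝ} (hη : 0 < η)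
    (h : PropertyG (fun i => dualCone (C i : Set X)) η) :
    LinearRegularityWith (fun i => (C i : Set X)) (1 / η) := by
  intro y
  have hcoe : (⋂ i, (C i : Set X)) = ((⨅ i, C i : PointedCone ℝ X) : Set X) := by simp
  set M := ⨆ i, Metric.infDist y (C i : Set X)
  have hM0 : 0 ≤ M := Real.iSup_nonneg fun i => Metric.infDist_nonneg
  obtain ⟨f, hf, hf1, hd⟩ := exists_mem_dualCone_infDist_le (⨅ i, C i) y
  rw [← hcoe] at hf hd
  obtain ⟨κ, _, _, _, J, p, hp, hlim, hle⟩ := h f (dualCone_iInter_subset_closure C hC hf)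
  have hlim' := ((WeakDual.eval_continuous y).tendsto _).comp hlim
  refine hd.trans (le_of_tendsto' hlim' fun k => ?_)
  simp only [Function.comp_apply, StrongDual.toWeakDual_apply, sum_apply]
  calc ∑ i ∈ J k, p k i y ≤ ∑ i ∈ J k, ‖p k i‖ * M := by
        refine Finset.sum_le_sum fun i hi =>
          (apply_le_of_mem_dualCone (C i) (hp k i hi) y).trans ?_
        gcongr
        exact le_ciSup (bddAbove_infDist_cone C y) i
    _ = (∑ i ∈ J k, ‖p k i‖) * M := (Finset.sum_mul _ _ _).symm
    _ ≤ 1 / η * ‖f‖ * M := by gcongr; exact hle k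
    _ ≤ 1 / η * 1 * M := by gcongr
    _ = 1 / η * M := by rw [mul_one]

/-- Sums with a single term suffice: a separating `y` would satisfy `γ * ‖f‖ * d(y, C i) ≤ u < f y ≤
‖f‖ * d(y, ⋂ i, C i)` for all `i`, against linear regularity. -/
theorem LinearRegularityWith.mem_closure_boundedSumSet [Nonempty I] (C : I → PointedCone ℝ X)
    {γ : ℝ} (hγ : 0 < γ) (h : LinearRegularityWith (fun i => (C i : Set X)) γ)
    {f : StrongDual ℝ X} (hf : f ∈ dualCone (⋂ i, (C i : Set X))) :
    StrongDual.toWeakDual f ∈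
      closure (StrongDual.toWeakDual '' boundedSumSet (fun i => (C i : Set X)) (γ * ‖f‖)) := by
  by_contra hnot
  obtain ⟨y, u, hu, hfu⟩ := exists_lt_of_notMem_closure_weakDual
    ((convex_boundedSumSet (fun i => (C i : Set X)) (γ * ‖f‖)).linear_image
      (StrongDual.toWeakDual (𝕜 := ℝ) (E := X)).toLinearMap) hnot
  rw [StrongDual.toWeakDual_apply] at hfu
  have hcoe : (⋂ i, (C i : Set X)) = ((⨅ i, C i : PointedCone ℝ X) : Set X) := by simp
  have hc : 0 ≤ γ * ‖f‖ := by positivity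
  have hi : ∀ i, γ * ‖f‖ * Metric.infDist y (C i : Set X) ≤ u := fun i => by
    obtain ⟨g, hg, hg1, hd⟩ := exists_mem_dualCone_infDist_le (C i) y
    have := hu (StrongDual.toWeakDual ((γ * ‖f‖) • g)) ⟨_, ⟨{i}, fun _ => (γ * ‖f‖) • g,
      by simpa using smul_mem_dualCone hg hc, by simp, by
        rw [Finset.sum_singleton, norm_smul, Real.norm_of_nonneg hc]
        exact mul_le_of_le_one_right hc hg1⟩, rfl⟩
    rw [StrongDual.toWeakDual_apply, smul_apply, smul_eq_mul] at this
    exact (mul_le_mul_of_nonneg_left hd hc).trans this.le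
  have h1 : γ * ‖f‖ * (⨆ i, Metric.infDist y (C i : Set X)) ≤ u := by
    rw [Real.mul_iSup_of_nonneg hc]
    exact ciSup_le hi
  have h2 : f y ≤ ‖f‖ * Metric.infDist y (⋂ i, (C i : Set X)) := by
    rw [hcoe] at hf ⊢
    exact apply_le_of_mem_dualCone _ hf y
  have h3 := mul_le_mul_of_nonneg_left (h y) (norm_nonneg f)
  linarith [mul_left_comm ‖f‖ γ (⨆ i, Metric.infDist y (C i : Set X)),
    mul_assoc γ ‖f‖ (⨆ i, Metric.infDist y (C i : Set X))]

theorem LinearRegularityWith.propertyG [Nonempty I] (C : I → PointedCone ℝ X)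
    {γ : ℝ} (hγ : 0 < γ) (h : LinearRegularityWith (fun i => (C i : Set X)) γ) :
    PropertyG (fun i => dualCone (C i : Set X)) (1 / γ) := by
  intro f hf
  have hmem := h.mem_closure_boundedSumSet C hγ (mem_dualCone_of_mem_closure C hf)
  obtain ⟨κ, _, _, _, g, hg, hlim⟩ := exists_net_of_mem_closure hmem
  choose s hs hsg using hg
  choose J p hp hsum hle using hs
  refine ⟨κ, inferInstance, inferInstance, inferInstance, J, p, hp, ?_, fun k => ?_⟩
  · simpa only [hsum, hsg] using hlim
  · rw [one_div_one_div]
    exact hle k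

end Duality

end ConvexSystem

open ConvexSystem in
theorem theorem5p5 {X : Type u} [NormedAddCommGroup X] [NormedSpace ℝ X] [CompleteSpace X]
    {I : Type v} [Nonempty I] [MetricSpace I] [CompactSpace I]
    (A : I → Set X) (hclosed : ∀ i, IsClosed (A i)) (hconvex : ∀ i, Convex ℝ (A i))
    (hne : (⋂ i, A i).Nonempty) (hlsc : LowerHemicontinuous A) :
    List.TFAE [
      ∃ γ : ℝ, 0 < γ ∧ ConvexSystem.LinearRegularityWith A γ,
      ConvexSystem.CHIP A ∧ ∃ η : ℝ, 0 < η ∧ ∀ x ∈ ⋂ i, A i,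
        ConvexSystem.NormalPropertyWith (fun i => ConvexSystem.tangentCone (A i) x) η,
      ConvexSystem.CHIP A ∧ ∃ η : ℝ, 0 < η ∧ ∀ x ∈ ⋂ i, A i,
        ConvexSystem.PropertyG (fun i => ConvexSystem.normalCone (A i) x) η,
      ConvexSystem.CHIP A ∧ ∃ γ : ℝ, 0 < γ ∧ ∀ x ∈ ⋂ i, A i,
        ConvexSystem.LinearRegularityWith (fun i => ConvexSystem.tangentCone (A i) x) γ] := by
  tfae_have 1 → 4 := by
    rintro ⟨γ, hγ, h⟩
    have hchip := h.chip hconvex hlsc hγ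
    refine ⟨hchip, γ, hγ, fun x hx v => ?_⟩
    rw [← hchip x hx]
    exact h.infDist_tangentCone_le hconvex hlsc hγ hx v
  tfae_have 4 → 1 := by
    rintro ⟨hchip, γ, hγ, h⟩
    exact ⟨γ, hγ, linearRegularityWith_of_tangentCone hclosed hconvex hne hchip hγ h⟩
  tfae_have 4 → 2 := by
    rintro ⟨hchip, γ, hγ, h⟩
    -- Any `η` with `γ * η < 1` would do; here the product is `1 / 2`.
    refine ⟨hchip, 1 / (2 * γ), by positivity, fun x hx =>
      (h x hx).normalPropertyWith ?_ hγ (by positivity) ?_⟩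
    · exact ⟨0, Set.mem_iInter.2 fun i => (tangentPointedCone (A i) x).zero_mem⟩
    · field_simp
      norm_num
  tfae_have 2 → 4 := by
    rintro ⟨hchip, η, hη, h⟩
    exact ⟨hchip, 1 / η, by positivity, fun x hx =>
      NormalPropertyWith.linearRegularityWith (fun i => tangentPointedCone (A i) x) hη (h x hx)⟩
  tfae_have 4 → 3 := by
    rintro ⟨hchip, γ, hγ, h⟩
    refine ⟨hchip, 1 / γ, by positivity, fun x hx => ?_⟩
    simp only [← dualCone_tangentCone]
    exact LinearRegularityWith.propertyG (fun i => tangentPointedCone (A i) x) hγ (h x hx)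
  tfae_have 3 → 4 := by
    rintro ⟨hchip, η, hη, h⟩
    refine ⟨hchip, 1 / η, by positivity, fun x hx => ?_⟩
    have hx := h x hx
    simp only [← dualCone_tangentCone] at hx
    exact PropertyG.linearRegularityWith (fun i => tangentPointedCone (A i) x)
      (fun i => isClosed_tangentCone (A i) x) hη hx
  tfae_finish
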